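/- For an integer $n\ge 1$ let $$B_n^*(x)=\sum_{r=0}^{n}\binom{n+r}{2r}\frac{B_r(x)}{n+r}$$ be the Zagier polynomial, where $B_r(x)$ is the classical Bernoulli polynomial, given by $\frac{te^{xt}}{e^t-1}=\sum_{r\ge 0}B_r(x)\frac{t^r}{r!}$. For real $x$ and integers $n\ge 1$ put $$A_{2n}^*(x)=B_{2n}^*(-1-x)-B_{2n}^*(-1).$$ Let $x\in\mathbb{R}$ and suppose that the sequence $\{A_{2n}^*(x)\}_{n\ge 1}$ is periodic, i.e. there is an integer $p\ge 1$ with $A_{2(n+p)}^*(x)=A_{2n}^*(x)$ for all $n\ge 1$. Then $x\in\{-1,0,1,2\}$. Conversely, for $x=-1$ and for $x=2$ the sequence $\{A_{2n}^*(x)\}_{n\ge 1}$ is periodic with least period $3$, and for $x=0$ and $x=1$ one has $A_{2n}^*(x)=0$ for all $n\ge 1$. -/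

import Mathlib

noncomputable section

/-- The Zagier polynomial `B*_n`, evaluated at a real number `x`, for `n > 0`:
`B*_n(x) = ∑_{r=0}^n C(n+r, 2r) B_r(x) / (n+r)`, where `B_r(x)` is the classical Bernoulli
polynomial. (The value at `n = 0` is meaningless and is never used.) -/
def zagierB (n : ℕ) (x : ℝ) : ℝ :=
  ∑ r ∈ Finset.range (n + 1),
    (Nat.choose (n + r) (2 * r) : ℝ) *
      (Polynomial.aeval x (Polynomial.bernoulli r) / ((n : ℝ) + (r : ℝ)))

/-- The function `A*_m(x) = B*_m(-1-x) - B*_m(-1)`; used for even `m = 2n > 0`. -/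
def zagierA (m : ℕ) (x : ℝ) : ℝ :=
  zagierB m (-1 - x) - zagierB m (-1)

/-- `p` is a period of the sequence `a_1, a_2, a_3, …`
(the sequence is indexed by the positive integers; `a 0` is ignored). -/
def IsPeriodOfSeq (a : ℕ → ℝ) (p : ℕ) : Prop :=
  0 < p ∧ ∀ n : ℕ, 1 ≤ n → a (n + p) = a n

/-- The sequence `a_1, a_2, a_3, …` is periodic. -/
def IsPeriodicSeq (a : ℕ → ℝ) : Prop :=
  ∃ p : ℕ, IsPeriodOfSeq a p

/-- The period (that is, the least period) of the sequence `a_1, a_2, a_3, …` is `p`. -/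
def HasMinimalPeriod (a : ℕ → ℝ) (p : ℕ) : Prop :=
  IsLeast {q : ℕ | IsPeriodOfSeq a q} p

end

/-!
The Zagier polynomials are read through the umbral functional `L_x : X ^ r ↦ B_r(x)`
(`bernoulliEval`). The numbers `2n C(n+r, 2r) / (n+r)` are the coefficients of `C_n(X + 2)`, where
`C_n` is the rescaled Chebyshev polynomial with `C_n(z + 1/z) = z ^ n + z ^ (-n)`, and `L_x`
turns a shift of the polynomial into a shift of the point. This gives
`B*_n(x) = L_{x+2}(C_n) / (2n)` (`zagierB_eq`) and, by the reflection formula,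
`A*_{2n}(x) = (L_x - L_0)(C_{2n}) / (4n)` (`zagierA_two_mul`). Two functional equations follow:
`A*_{2n}(1 - x) = A*_{2n}(x)`, and `A*_{2n}(x + 1) = A*_{2n}(x) + S_{2n-1}(x) / 2` because
`L_{x+1} - L_x` is evaluation of the derivative at `x` and `C_n' = n S_{n-1}`.

A periodic sequence is bounded, and boundedness alone already forces `x` to be an integer
(`exists_int_of_bounded`). Indeed, by repeated use of `X ^ 2 C_{2n} = C_{2n+2} + 2 C_{2n} + C_{2n-2}`,
a bound on `A*_{2n}(x)` makes `B_{2k}(x) - B_{2k}(0)` grow at most exponentially in `k`. This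
property depends only on `x` modulo `1`, and for `0 < y < 1` it contradicts the Fourier expansion of
`B_{2k}`, which yields
`|B_{2k}(y) - B_{2k}(0)| ≥ 2 (2k)! (2π) ^ (-2k) (1 - cos 2πy)`.

For integers the functional equations compute everything: `A*_{2n}` vanishes at `0` and `1`, equals
`S_{2n-1}(1) / 2` at `2` and `-1`, which has period `3`, and is unbounded at `3, 4, 5, …` because
`S_{2n-1}(2) = 2n` and `S_{2n-1} ≥ 0` on `[2, ∞)`.
-/

open Polynomial Finset

noncomputable section

/-! ### The Bernoulli functional -/

/-- The umbral functional `X ^ r ↦ B_r(x)`: the linear form on `ℝ[X]` replacing each power of the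
variable by the value at `x` of the Bernoulli polynomial of that degree. -/
def bernoulliEval (x : ℝ) : ℝ[X] →ₗ[ℝ] ℝ :=
  lsum fun r => (aeval x (bernoulli r) : ℝ) • LinearMap.id

theorem bernoulliEval_X_pow (x : ℝ) (r : ℕ) :
    bernoulliEval x (X ^ r) = aeval x (bernoulli r) := by
  simp [bernoulliEval, X_pow_eq_monomial, lsum_apply]

theorem linearMap_ext_X_pow {f g : ℝ[X] →ₗ[ℝ] ℝ} (h : ∀ r, f (X ^ r) = g (X ^ r)) (p : ℝ[X]) :
    f p = g p := by
  refine congrArg (fun l : ℝ[X] →ₗ[ℝ] ℝ => l p) (lhom_ext' fun r => LinearMap.ext_ring ?_)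
  simpa [X_pow_eq_monomial] using h r

theorem bernoulliEval_add_one (x : ℝ) (p : ℝ[X]) :
    bernoulliEval (x + 1) p = bernoulliEval x p + (derivative p).eval x := by
  refine linearMap_ext_X_pow (g := bernoulliEval x + (leval x).comp derivative) (fun r => ?_) p
  have h := congrArg (aeval x) (bernoulli_comp_one_add_X r)
  simp only [aeval_comp] at h
  simpa [bernoulliEval_X_pow, add_comm, derivative_X_pow] using h

theorem bernoulliEval_one_sub (x : ℝ) (p : ℝ[X]) :
    bernoulliEval (1 - x) p = bernoulliEval x (p.comp (-X)) := by
  refine linearMap_ext_X_pow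
    (g := (bernoulliEval x).comp (aeval (-X : ℝ[X])).toLinearMap) (fun r => ?_) p
  have h := congrArg (aeval x) (bernoulli_comp_one_sub_X r)
  simp only [aeval_comp] at h
  have h1 : ((-X : ℝ[X])) ^ r = ((-1 : ℝ) ^ r) • X ^ r := by
    rw [neg_pow, smul_eq_C_mul]; simp
  simpa [bernoulliEval_X_pow, h1] using h

/-- Translating the argument of the functional translates the point. On `X ^ (n + 1)` this combines
`∑_{k ≤ n} C(n+1, k) B_k(x) = (n+1) x ^ n` with the difference equation of `B_{n+1}`. -/
theorem bernoulliEval_comp_X_add_one (x : ℝ) (p : ℝ[X]) :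
    bernoulliEval x (p.comp (X + 1)) = bernoulliEval (x + 1) p := by
  refine linearMap_ext_X_pow
    (f := (bernoulliEval x).comp (aeval (X + 1 : ℝ[X])).toLinearMap) (fun r => ?_) p
  rw [bernoulliEval_add_one]
  rcases r with _ | n
  · simp
  · have h := congrArg (aeval x) (sum_bernoulli n)
    simp only [map_sum, map_smul, aeval_monomial] at h
    have h2 : ((X : ℝ[X]) + 1) ^ (n + 1)
        = ∑ k ∈ range (n + 1), ((n + 1).choose k : ℝ) • X ^ k + X ^ (n + 1) := by
      rw [add_pow, sum_range_succ]
      simp [smul_eq_C_mul, mul_comm]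
    have h3 : ∑ k ∈ range (n + 1), ((n + 1).choose k : ℝ) * aeval x (bernoulli k)
        = (n + 1) * x ^ n := by
      simpa [Algebra.smul_def] using h
    simp only [LinearMap.comp_apply, AlgHom.toLinearMap_apply, map_pow, aeval_X, h2, map_add,
      map_sum, map_smul, bernoulliEval_X_pow, smul_eq_mul, h3]
    simp [add_comm]

/-! ### Zagier polynomials through Chebyshev polynomials -/

/-- The Morgan-Voyce polynomial `b_n = ∑_r C(n+r, 2r) X ^ r`. -/
def morganVoyceFirst (n : ℕ) : ℝ[X] := ∑ r ∈ range (n + 1), ((n + r).choose (2 * r) : ℝ) • X ^ r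

/-- The Morgan-Voyce polynomial `B_n = ∑_r C(n+r+1, 2r+1) X ^ r`. -/
def morganVoyceSecond (n : ℕ) : ℝ[X] :=
  ∑ r ∈ range (n + 1), ((n + r + 1).choose (2 * r + 1) : ℝ) • X ^ r

theorem morganVoyceSecond_succ (n : ℕ) :
    morganVoyceSecond (n + 1) = morganVoyceFirst (n + 1) + morganVoyceSecond n := by
  have h : morganVoyceSecond n
      = ∑ r ∈ range (n + 2), ((n + r + 1).choose (2 * r + 1) : ℝ) • (X : ℝ[X]) ^ r := by
    rw [sum_range_succ, Nat.choose_eq_zero_of_lt (by omega)]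
    simp [morganVoyceSecond]
  rw [h, morganVoyceSecond, morganVoyceFirst, ← sum_add_distrib]
  refine sum_congr rfl fun r _ => ?_
  rw [← add_smul, show n + 1 + r + 1 = (n + r + 1) + 1 by ring, Nat.choose_succ_succ,
    show n + 1 + r = n + r + 1 by ring]
  push_cast
  rfl

theorem morganVoyceFirst_succ (n : ℕ) :
    morganVoyceFirst (n + 1) = morganVoyceFirst n + X * morganVoyceSecond n := by
  have h : morganVoyceFirst n
      = ∑ r ∈ range (n + 2), ((n + r).choose (2 * r) : ℝ) • (X : ℝ[X]) ^ r := by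
    rw [sum_range_succ, Nat.choose_eq_zero_of_lt (by omega)]
    simp [morganVoyceFirst]
  rw [h, morganVoyceFirst, morganVoyceSecond, sum_range_succ', sum_range_succ' _ (n + 1), mul_sum,
    add_right_comm (∑ _ ∈ _, _), ← sum_add_distrib]
  congr 1
  · refine sum_congr rfl fun r _ => ?_
    rw [mul_smul_comm, ← pow_succ', ← add_smul, show n + 1 + (r + 1) = (n + r + 1) + 1 by ring,
      show 2 * (r + 1) = (2 * r + 1) + 1 by ring, Nat.choose_succ_succ]
    push_cast
    rw [add_comm, ← add_assoc n r 1]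
  · simp

theorem chebyshevC_comp_X_add_two (n : ℕ) :
    (Chebyshev.C ℝ ((n : ℤ) + 1)).comp (X + 2) = morganVoyceFirst (n + 1) + morganVoyceFirst n := by
  induction n using Nat.twoStepInduction with
  | zero => simp [morganVoyceFirst, sum_range_succ]; ring
  | one =>
    norm_num [morganVoyceFirst, sum_range_succ, Chebyshev.C_two, Nat.choose, smul_eq_C_mul]
    ring_nf
  | more n h1 h2 =>
    have e := Chebyshev.C_add_two ℝ ((n : ℤ) + 1)
    push_cast at h2 ⊢
    rw [show (n : ℤ) + 2 + 1 = n + 1 + 2 by ring, e, sub_comp, mul_comp, h1, h2, X_comp,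
      morganVoyceFirst_succ (n + 2), morganVoyceSecond_succ (n + 1), morganVoyceFirst_succ (n + 1),
      morganVoyceSecond_succ n, morganVoyceFirst_succ n]
    ring

/-- The weights `C(n+r, 2r) / (n+r)` of the Zagier polynomial are the coefficients of
`C_n(X + 2) / (2n)`; the shift by `2` is then moved from the polynomial to the point. -/
theorem zagierB_eq (n : ℕ) (hn : 1 ≤ n) (x : ℝ) :
    zagierB n x = bernoulliEval (x + 2) (Chebyshev.C ℝ n) / (2 * n) := by
  obtain ⟨m, rfl⟩ : ∃ m, n = m + 1 := ⟨n - 1, by omega⟩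
  have h : morganVoyceFirst m
      = ∑ r ∈ range (m + 2), ((m + r).choose (2 * r) : ℝ) • (X : ℝ[X]) ^ r := by
    rw [sum_range_succ, Nat.choose_eq_zero_of_lt (by omega)]
    simp [morganVoyceFirst]
  have hc : (X + 2 : ℝ[X]) = (X + 1 : ℝ[X]).comp (X + 1) := by
    simp only [add_comp, X_comp, one_comp]; ring
  have hs : bernoulliEval (x + 2) (Chebyshev.C ℝ ((m + 1 : ℕ) : ℤ))
      = bernoulliEval x (morganVoyceFirst (m + 1) + morganVoyceFirst m) := by
    rw [← chebyshevC_comp_X_add_two, hc, ← comp_assoc, bernoulliEval_comp_X_add_one,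
      bernoulliEval_comp_X_add_one]
    push_cast
    norm_num [add_assoc]
  rw [hs, h, morganVoyceFirst, ← sum_add_distrib, map_sum, sum_div, zagierB]
  refine sum_congr rfl fun r hr => ?_
  have hr' : r ≤ m + 1 := by simpa [Nat.lt_succ_iff] using hr
  have hch : ((m + r).choose (2 * r) : ℝ) * (m + r + 1)
      = ((m + 1 + r).choose (2 * r) : ℝ) * (m + 1 - r) := by
    rw [add_right_comm m 1 r]
    rcases hr'.lt_or_eq with hlt | rfl
    · have := Nat.choose_mul_succ_eq (m + r) (2 * r)
      rw [show m + r + 1 - 2 * r = m + 1 - r by omega] at this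
      have := congrArg (Nat.cast : ℕ → ℝ) this
      rw [Nat.cast_mul, Nat.cast_mul, Nat.cast_sub hr'] at this
      exact_mod_cast this
    -- For `r = m + 1` both sides vanish.
    · rw [Nat.choose_eq_zero_of_lt (by omega)]
      simp
  rw [← add_smul, map_smul, bernoulliEval_X_pow, smul_eq_mul]
  push_cast
  have h0 : (m : ℝ) + 1 + r ≠ 0 := by positivity
  have h1 : (m : ℝ) + 1 ≠ 0 := by positivity
  field_simp
  linear_combination (-aeval x (bernoulli r)) * hch

theorem chebyshevC_comp_neg_X (n : ℤ) :
    (Chebyshev.C ℝ (2 * n)).comp (-X) = Chebyshev.C ℝ (2 * n) := by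
  rw [mul_comm, Chebyshev.C_mul, comp_assoc]
  simp [Chebyshev.C_two]

theorem derivative_chebyshevC (n : ℤ) :
    derivative (Chebyshev.C ℝ n) = n * Chebyshev.S ℝ (n - 1) := by
  let _ : Invertible (2 : ℝ) := invertibleOfNonzero two_ne_zero
  rw [Chebyshev.C_eq_two_mul_T_comp_half_mul_X, Chebyshev.S_eq_U_comp_half_mul_X]
  simp only [derivative_mul, derivative_comp, Chebyshev.T_derivative_eq_U, derivative_ofNat,
    derivative_C, derivative_X, mul_comp, intCast_comp]
  have : (2 : ℝ[X]) * Polynomial.C (⅟2 : ℝ) = 1 := by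
    rw [← map_ofNat Polynomial.C 2, ← C_mul]; simp
  linear_combination ((n : ℝ[X]) * (Chebyshev.U ℝ (n - 1)).comp (Polynomial.C (⅟2 : ℝ) * X)) * this

theorem bernoulliEval_one_sub_chebyshevC (n : ℤ) (x : ℝ) :
    bernoulliEval (1 - x) (Chebyshev.C ℝ (2 * n)) = bernoulliEval x (Chebyshev.C ℝ (2 * n)) := by
  rw [bernoulliEval_one_sub, chebyshevC_comp_neg_X]

/-- The reflection `B_r(1 - x) = (-1) ^ r B_r(x)` replaces the points `1 - x` and `1` by `x` and `0`,
because `C_{2n}` is even. -/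
theorem zagierA_two_mul (n : ℕ) (hn : 1 ≤ n) (x : ℝ) :
    zagierA (2 * n) x = (bernoulliEval x (Chebyshev.C ℝ (2 * n))
      - bernoulliEval 0 (Chebyshev.C ℝ (2 * n))) / (4 * n) := by
  rw [zagierA, zagierB_eq _ (by omega), zagierB_eq _ (by omega), ← sub_div,
    show -1 - x + 2 = 1 - x by ring, show (-1 : ℝ) + 2 = 1 - 0 by ring]
  push_cast
  rw [bernoulliEval_one_sub_chebyshevC, bernoulliEval_one_sub_chebyshevC]
  ring

theorem zagierA_one_sub (n : ℕ) (hn : 1 ≤ n) (x : ℝ) :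
    zagierA (2 * n) (1 - x) = zagierA (2 * n) x := by
  rw [zagierA_two_mul n hn, zagierA_two_mul n hn, bernoulliEval_one_sub_chebyshevC]

theorem zagierA_add_one (n : ℕ) (hn : 1 ≤ n) (x : ℝ) :
    zagierA (2 * n) (x + 1) = zagierA (2 * n) x + (Chebyshev.S ℝ (2 * n - 1)).eval x / 2 := by
  rw [zagierA_two_mul n hn, zagierA_two_mul n hn, bernoulliEval_add_one, derivative_chebyshevC]
  have : (n : ℝ) ≠ 0 := by positivity
  simp
  field_simp
  ring

/-! ### Bounded sequences force integral arguments -/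

theorem X_sq_mul_chebyshevC (n : ℤ) :
    X ^ 2 * Chebyshev.C ℝ (2 * n) = Chebyshev.C ℝ (2 * (n + 1))
      + 2 * Chebyshev.C ℝ (2 * n) + Chebyshev.C ℝ (2 * (n - 1)) := by
  have h := Chebyshev.C_mul_C ℝ (2 * n) 2
  rw [Chebyshev.C_two] at h
  rw [mul_add, mul_sub, mul_one]
  linear_combination h

/-- A linear form of linear growth on the even Chebyshev polynomials has exponential growth on the
even powers of `X`: multiplication by `X ^ 2` expresses `C_{2n}` through its neighbours with
coefficients of sum `4`. Indices run over `ℤ` so that no boundary case arises at `n = 0`. -/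
theorem abs_X_pow_mul_chebyshevC_le {D : ℝ[X] →ₗ[ℝ] ℝ} {K : ℝ} (hK : 0 ≤ K)
    (hD : ∀ n : ℤ, |D (Chebyshev.C ℝ (2 * n))| ≤ K * |(n : ℝ)|) (j : ℕ) (n : ℤ) :
    |D (X ^ (2 * j) * Chebyshev.C ℝ (2 * n))| ≤ 4 ^ j * (K * (|(n : ℝ)| + j)) := by
  induction j generalizing n with
  | zero => simpa using hD n
  | succ j ih =>
    have e : X ^ (2 * (j + 1)) * Chebyshev.C ℝ (2 * n)
        = X ^ (2 * j) * Chebyshev.C ℝ (2 * (n + 1))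
          + (2 : ℝ) • (X ^ (2 * j) * Chebyshev.C ℝ (2 * n))
          + X ^ (2 * j) * Chebyshev.C ℝ (2 * (n - 1)) := by
      rw [mul_add, pow_add, mul_one, mul_assoc, X_sq_mul_chebyshevC, smul_eq_C_mul, map_ofNat]
      ring
    rw [e, map_add, map_add, map_smul, smul_eq_mul]
    have hp : |((n + 1 : ℤ) : ℝ)| ≤ |(n : ℝ)| + 1 := by
      push_cast; simpa using abs_add_le (n : ℝ) 1
    have hm : |((n - 1 : ℤ) : ℝ)| ≤ |(n : ℝ)| + 1 := by
      push_cast; simpa using abs_sub (n : ℝ) 1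
    calc _ ≤ 4 ^ j * (K * (|((n + 1 : ℤ) : ℝ)| + j)) + 2 * (4 ^ j * (K * (|(n : ℝ)| + j)))
          + 4 ^ j * (K * (|((n - 1 : ℤ) : ℝ)| + j)) := by
            refine (abs_add_three _ _ _).trans ?_
            rw [abs_mul, abs_two]
            gcongr
            exacts [ih _, ih _, ih _]
      _ ≤ 4 ^ j * (K * (|(n : ℝ)| + 1 + j)) + 2 * (4 ^ j * (K * (|(n : ℝ)| + 1 + j)))
          + 4 ^ j * (K * (|(n : ℝ)| + 1 + j)) := by
            gcongr
            linarith
      _ = _ := by push_cast; ring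

/-- The sequence `f` grows at most exponentially. -/
def IsExpBounded (f : ℕ → ℝ) : Prop :=
  ∃ C R : ℝ, 0 ≤ C ∧ 0 ≤ R ∧ ∀ k, |f k| ≤ C * R ^ k

theorem IsExpBounded.add {f g : ℕ → ℝ} (hf : IsExpBounded f) (hg : IsExpBounded g) :
    IsExpBounded fun k => f k + g k := by
  obtain ⟨C, R, hC, hR, h⟩ := hf
  obtain ⟨C', R', hC', hR', h'⟩ := hg
  refine ⟨C + C', R + R', by positivity, by positivity, fun k => ?_⟩
  calc |f k + g k| ≤ C * R ^ k + C' * R' ^ k := (abs_add_le _ _).trans (add_le_add (h k) (h' k))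
    _ ≤ C * (R + R') ^ k + C' * (R + R') ^ k := by gcongr <;> linarith
    _ = _ := by ring

theorem IsExpBounded.neg {f : ℕ → ℝ} (hf : IsExpBounded f) : IsExpBounded fun k => -f k := by
  simpa [IsExpBounded] using hf

theorem isExpBounded_deriv_pow (x : ℝ) :
    IsExpBounded fun k => (derivative (X ^ (2 * k) : ℝ[X])).eval x := by
  refine ⟨2, 2 * (1 + |x|) ^ 2, by positivity, by positivity, fun k => ?_⟩
  simp only [derivative_X_pow, eval_mul, eval_pow, eval_X, eval_C, abs_mul, abs_pow, Nat.abs_cast]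
  have hk : (k : ℝ) ≤ 2 ^ k := by exact_mod_cast Nat.lt_two_pow_self.le
  calc ((2 * k : ℕ) : ℝ) * |x| ^ (2 * k - 1) ≤ (2 * 2 ^ k) * (1 + |x|) ^ (2 * k) := by
        push_cast
        gcongr
        calc |x| ^ (2 * k - 1) ≤ (1 + |x|) ^ (2 * k - 1) := by gcongr; linarith
          _ ≤ (1 + |x|) ^ (2 * k) :=
            pow_le_pow_right₀ (by linarith [abs_nonneg x]) (Nat.sub_le _ _)
    _ = _ := by rw [pow_mul, mul_pow]; ring

/-- The sequence `k ↦ B_{2k}(x) - B_{2k}(0)`. -/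
def bernoulliDiff (x : ℝ) (k : ℕ) : ℝ :=
  bernoulliEval x (X ^ (2 * k)) - bernoulliEval 0 (X ^ (2 * k))

theorem isExpBounded_bernoulliDiff_add_one_iff (x : ℝ) :
    IsExpBounded (bernoulliDiff (x + 1)) ↔ IsExpBounded (bernoulliDiff x) := by
  have e (k : ℕ) : bernoulliDiff (x + 1) k
      = bernoulliDiff x k + (derivative (X ^ (2 * k) : ℝ[X])).eval x := by
    rw [bernoulliDiff, bernoulliDiff, bernoulliEval_add_one]; ring
  constructor <;> intro h
  · convert h.add (isExpBounded_deriv_pow x).neg using 2 with k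
    rw [e]; ring
  · convert h.add (isExpBounded_deriv_pow x) using 2 with k
    rw [e]

theorem isExpBounded_bernoulliDiff_add_int_iff (x : ℝ) (m : ℤ) :
    IsExpBounded (bernoulliDiff (x + m)) ↔ IsExpBounded (bernoulliDiff x) := by
  induction m using Int.induction_on with
  | zero => simp
  | succ i ih =>
    rw [← ih, ← isExpBounded_bernoulliDiff_add_one_iff (x + (i : ℤ))]
    push_cast
    rw [add_assoc]
  | pred i ih =>
    rw [← ih, ← isExpBounded_bernoulliDiff_add_one_iff (x + (-i - 1 : ℤ))]
    push_cast
    ring_nf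

/-- A factorial lower bound for `|B_{2k}(y) - B_{2k}(0)|`. In the difference of the Fourier series at
`0` and `y` all terms `(1 - cos (2πjy)) / j ^ (2k)` are nonnegative, so the sum dominates the term
`j = 1`. -/
theorem one_sub_cos_le_abs_bernoulliDiff {y : ℝ} (hy : y ∈ Set.Icc (0 : ℝ) 1) {k : ℕ}
    (hk : k ≠ 0) :
    1 - Real.cos (2 * Real.pi * y)
      ≤ (2 * Real.pi) ^ (2 * k) / 2 / (2 * k).factorial * |bernoulliDiff y k| := by
  have h := (hasSum_one_div_nat_pow_mul_cos hk (Set.left_mem_Icc.mpr zero_le_one)).sub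
    (hasSum_one_div_nat_pow_mul_cos hk hy)
  have h1 := le_hasSum h 1 fun j _ => by
    rw [← mul_sub]
    have := Real.cos_le_one (2 * Real.pi * j * y)
    refine mul_nonneg (by positivity) ?_
    simpa using this
  refine le_trans (le_of_eq ?_) (h1.trans ((le_abs_self _).trans (le_of_eq ?_)))
  · simp
  · rw [← mul_sub, abs_mul, abs_sub_comm, bernoulliDiff, bernoulliEval_X_pow, bernoulliEval_X_pow,
      eval_map_algebraMap, eval_map_algebraMap]
    congr 1
    rw [abs_div, abs_div, abs_mul, abs_pow, abs_neg, abs_one, one_pow, one_mul, abs_two,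
      Nat.abs_cast, abs_of_pos (by positivity)]

theorem not_isExpBounded_bernoulliDiff {y : ℝ} (hy : y ∈ Set.Ioo (0 : ℝ) 1) :
    ¬ IsExpBounded (bernoulliDiff y) := by
  rintro ⟨C, R, hC, hR, h⟩
  have hlt : 0 < 1 - Real.cos (2 * Real.pi * y) := by
    refine sub_pos.2 (lt_of_le_of_ne (Real.cos_le_one _) fun hc => ?_)
    obtain ⟨n, hn⟩ := (Real.cos_eq_one_iff _).1 hc
    have hny : (n : ℝ) = y := by
      have := Real.pi_pos
      have : (n - y) * (2 * Real.pi) = 0 := by linarith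
      rcases mul_eq_zero.1 this with h | h <;> linarith
    rw [← hny] at hy
    have h0 : (0 : ℤ) < n := by exact_mod_cast hy.1
    have h1 : n < (1 : ℤ) := by exact_mod_cast hy.2
    omega
  have hlim := ((FloorSemiring.tendsto_pow_div_factorial_atTop
    (2 * Real.pi * (1 + R))).comp (Filter.tendsto_id.const_mul_atTop' two_pos)).mul_const (C / 2)
  rw [zero_mul] at hlim
  refine hlt.not_ge (ge_of_tendsto hlim ?_)
  filter_upwards [Filter.eventually_ne_atTop 0] with k hk
  refine (one_sub_cos_le_abs_bernoulliDiff ⟨hy.1.le, hy.2.le⟩ hk).trans ?_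
  have hRk : R ^ k ≤ (1 + R) ^ (2 * k) := by
    calc R ^ k ≤ (1 + R) ^ k := by gcongr; linarith
      _ ≤ (1 + R) ^ (2 * k) := pow_le_pow_right₀ (by linarith) (by omega)
  calc _ ≤ (2 * Real.pi) ^ (2 * k) / 2 / (2 * k).factorial * (C * (1 + R) ^ (2 * k)) := by
        gcongr
        exact (h k).trans (by gcongr)
    _ = _ := by
        simp only [Function.comp, id, mul_pow]
        ring

/-- Since `(L_x - L_0)(C_{2n}) = 4n A*_{2n}(x)`, where `L_x` is `bernoulliEval x`, a bound on
`A*_{2n}(x)` controls the values of `L_x - L_0` on even powers of `X`. -/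
theorem isExpBounded_bernoulliDiff_of_bounded {x M : ℝ}
    (hM : ∀ n : ℕ, 1 ≤ n → |zagierA (2 * n) x| ≤ M) : IsExpBounded (bernoulliDiff x) := by
  have hM0 : 0 ≤ M := (abs_nonneg _).trans (hM 1 le_rfl)
  let D := bernoulliEval x - bernoulliEval 0
  have h2 : D 2 = 0 := by
    have : (2 : ℝ[X]) = (2 : ℝ) • X ^ 0 := by
      rw [pow_zero, smul_eq_C_mul, map_ofNat, mul_one]
    rw [this, map_smul, LinearMap.sub_apply, bernoulliEval_X_pow, bernoulliEval_X_pow]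
    simp
  have hnat (n : ℕ) : |D (Chebyshev.C ℝ (2 * n))| ≤ 4 * M * n := by
    rcases Nat.eq_zero_or_pos n with rfl | hn
    · simp [h2]
    · have hA := hM n hn
      have hn' : (0 : ℝ) < 4 * n := by positivity
      rw [zagierA_two_mul n hn, abs_div, div_le_iff₀ (by positivity), abs_of_pos hn'] at hA
      calc _ ≤ M * (4 * n) := hA
        _ = _ := by ring
  have hint (n : ℤ) : |D (Chebyshev.C ℝ (2 * n))| ≤ 4 * M * |(n : ℝ)| := by
    obtain ⟨m, rfl | rfl⟩ := n.eq_nat_or_neg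
    · simpa using hnat m
    · rw [mul_neg, Chebyshev.C_neg]
      simpa using hnat m
  refine ⟨2 * M, 8, by positivity, by norm_num, fun k => ?_⟩
  have h := abs_X_pow_mul_chebyshevC_le (D := D) (by positivity) hint k 0
  have e : X ^ (2 * k) * Chebyshev.C ℝ (2 * 0) = (2 : ℝ) • X ^ (2 * k) := by
    rw [mul_zero, Chebyshev.C_zero, smul_eq_C_mul, map_ofNat, mul_comm]
  rw [e, map_smul, smul_eq_mul, abs_mul, abs_two] at h
  have hk : (k : ℝ) ≤ 2 ^ k := by exact_mod_cast Nat.lt_two_pow_self.le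
  have h' : 2 * |bernoulliDiff x k| ≤ 4 ^ k * (4 * M * k) := by
    rw [Int.cast_zero, abs_zero, zero_add] at h
    exact h
  calc |bernoulliDiff x k| ≤ 2 * M * (4 ^ k * k) := by linarith
    _ ≤ 2 * M * (4 ^ k * 2 ^ k) := by gcongr
    _ = _ := by rw [← mul_pow]; norm_num

theorem exists_int_of_bounded {x M : ℝ} (hM : ∀ n : ℕ, 1 ≤ n → |zagierA (2 * n) x| ≤ M) :
    ∃ m : ℤ, x = m := by
  have h := isExpBounded_bernoulliDiff_of_bounded hM
  rw [← Int.fract_add_floor x, isExpBounded_bernoulliDiff_add_int_iff] at h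
  by_contra hx
  refine not_isExpBounded_bernoulliDiff ⟨(Int.fract_nonneg x).lt_of_ne fun h0 => hx ?_,
    Int.fract_lt_one x⟩ h
  exact ⟨⌊x⌋, by linarith [Int.self_sub_floor x]⟩

theorem IsPeriodicSeq.exists_abs_le {a : ℕ → ℝ} (h : IsPeriodicSeq a) :
    ∃ M, ∀ n, 1 ≤ n → |a n| ≤ M := by
  obtain ⟨p, hp, ha⟩ := h
  have hper : Function.Periodic (fun n => a (n + 1)) p := fun n => by
    simpa [add_right_comm] using ha (n + 1) (by omega)
  refine ⟨∑ i ∈ range p, |a (i + 1)|, fun n hn => ?_⟩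
  obtain ⟨m, rfl⟩ : ∃ m, n = m + 1 := ⟨n - 1, by omega⟩
  have := hper.map_mod_nat m
  rw [← this]
  exact single_le_sum (f := fun i => |a (i + 1)|) (fun _ _ => abs_nonneg _)
    (mem_range.2 (Nat.mod_lt m hp))

/-! ### Integral arguments -/

theorem chebyshevS_eval_nonneg {t : ℝ} (ht : 2 ≤ t) (n : ℕ) :
    0 ≤ (Chebyshev.S ℝ n).eval t ∧
      (Chebyshev.S ℝ n).eval t ≤ (Chebyshev.S ℝ ((n : ℤ) + 1)).eval t := by
  induction n with
  | zero => simp; linarith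
  | succ n ih =>
    have e : (Chebyshev.S ℝ ((n : ℤ) + 1 + 1)).eval t = t * (Chebyshev.S ℝ ((n : ℤ) + 1)).eval t
        - (Chebyshev.S ℝ n).eval t := by
      rw [add_assoc, one_add_one_eq_two, Chebyshev.S_add_two]; simp
    push_cast
    refine ⟨ih.1.trans ih.2, ?_⟩
    rw [e]
    nlinarith [ih.1, ih.2]

theorem chebyshevS_eval_one_add_six (n : ℤ) :
    (Chebyshev.S ℝ (n + 6)).eval 1 = (Chebyshev.S ℝ n).eval 1 := by
  have h (k : ℤ) : (Chebyshev.S ℝ (k + 3)).eval 1 = -(Chebyshev.S ℝ k).eval 1 := by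
    have h1 := congrArg (eval 1) (Chebyshev.S_add_two ℝ k)
    have h2 := congrArg (eval 1) (Chebyshev.S_add_two ℝ (k + 1))
    rw [show k + 1 + 2 = k + 3 by ring, show k + 1 + 1 = k + 2 by ring] at h2
    simp only [eval_sub, eval_mul, eval_X] at h1 h2
    linarith
  rw [show n + 6 = n + 3 + 3 by ring, h, h, neg_neg]

theorem zagierA_zero {n : ℕ} (hn : 1 ≤ n) : zagierA (2 * n) 0 = 0 := by
  rw [zagierA_two_mul n hn]; simp

theorem zagierA_one {n : ℕ} (hn : 1 ≤ n) : zagierA (2 * n) 1 = 0 := by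
  simpa [zagierA_zero hn] using zagierA_one_sub n hn 0

theorem zagierA_two {n : ℕ} (hn : 1 ≤ n) :
    zagierA (2 * n) 2 = (Chebyshev.S ℝ (2 * n - 1)).eval 1 / 2 := by
  simpa [zagierA_one hn, one_add_one_eq_two] using zagierA_add_one n hn 1

/-- `A*_{2n}(2) = S_{2n-1}(1) / 2` has period `3`, as `S_k(1)` has period `6` in `k`. The first values
`1/2, -1/2, 0` exclude the periods `1` and `2`. -/
theorem hasMinimalPeriod_zagierA_two :
    HasMinimalPeriod (fun n : ℕ => zagierA (2 * n) 2) 3 := by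
  have v1 : zagierA (2 * 1) 2 = 1 / 2 := by rw [zagierA_two le_rfl]; norm_num
  have h2 : (Chebyshev.S ℝ 2).eval 1 = 0 := by simp [Chebyshev.S_two]
  have h3 : (Chebyshev.S ℝ 3).eval 1 = -1 := by
    rw [show (3 : ℤ) = 1 + 2 by norm_num, Chebyshev.S_add_two]; norm_num [h2]
  have h4 : (Chebyshev.S ℝ 4).eval 1 = -1 := by
    rw [show (4 : ℤ) = 2 + 2 by norm_num, Chebyshev.S_add_two]; norm_num [h2, h3]
  have h5 : (Chebyshev.S ℝ 5).eval 1 = 0 := by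
    rw [show (5 : ℤ) = 3 + 2 by norm_num, Chebyshev.S_add_two]; norm_num [h4, h3]
  have v2 : zagierA (2 * 2) 2 = -1 / 2 := by rw [zagierA_two one_le_two]; norm_num [h3]
  have v3 : zagierA (2 * 3) 2 = 0 := by rw [zagierA_two (by norm_num)]; norm_num [h5]
  refine ⟨⟨by norm_num, fun n hn => ?_⟩, ?_⟩
  · simp only
    rw [zagierA_two (by omega), zagierA_two hn, ← chebyshevS_eval_one_add_six (2 * n - 1)]
    push_cast
    ring_nf
  · rintro q ⟨hq, h⟩
    by_contra! hlt
    have := h 1 le_rfl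
    simp only at this
    interval_cases q
    · norm_num at this v1 v2
      linarith
    · norm_num at this v1 v3
      linarith

/-- The step from `2` to `3` adds `S_{2n-1}(2) / 2 = n`, and all later steps add something
nonnegative. -/
theorem zagierA_nat_add_three_ge {n : ℕ} (hn : 1 ≤ n) (j : ℕ) :
    zagierA (2 * n) 2 + n ≤ zagierA (2 * n) (j + 3) := by
  induction j with
  | zero =>
    have h := zagierA_add_one n hn 2
    rw [Chebyshev.S_eval_two] at h
    push_cast at h ⊢
    rw [zero_add, show (3 : ℝ) = 2 + 1 by norm_num, h]
    linarith
  | succ j ih =>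
    have h := zagierA_add_one n hn (j + 3)
    have hS := (chebyshevS_eval_nonneg (t := (j : ℝ) + 3)
      (by linarith [(j.cast_nonneg : (0 : ℝ) ≤ j)]) (2 * n - 1)).1
    rw [Nat.cast_sub (by omega)] at hS
    push_cast at hS ⊢
    rw [add_right_comm, h]
    linarith

theorem not_bounded_zagierA_nat_add_three (j : ℕ) (M : ℝ) :
    ¬ ∀ n : ℕ, 1 ≤ n → |zagierA (2 * n) (j + 3)| ≤ M := by
  intro hM
  obtain ⟨M', hM'⟩ := IsPeriodicSeq.exists_abs_le ⟨3, Set.mem_ofPred.1 hasMinimalPeriod_zagierA_two.1⟩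
  obtain ⟨n, hn⟩ := exists_nat_gt (max (M + M') 1)
  have hn1 : 1 ≤ n := by exact_mod_cast (lt_of_le_of_lt (le_max_right _ _) hn).le
  have h1 := (abs_le.1 (hM n hn1)).2
  have h2 := (abs_le.1 (hM' n hn1)).1
  have h3 := zagierA_nat_add_three_ge hn1 j
  linarith [le_max_left (M + M') 1]

theorem theorem1p3 :
    (∀ x : ℝ, IsPeriodicSeq (fun n : ℕ => zagierA (2 * n) x) →
      x ∈ ({-1, 0, 1, 2} : Set ℝ)) ∧
    HasMinimalPeriod (fun n : ℕ => zagierA (2 * n) (-1)) 3 ∧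
    HasMinimalPeriod (fun n : ℕ => zagierA (2 * n) 2) 3 ∧
    (∀ n : ℕ, 1 ≤ n → zagierA (2 * n) 0 = 0) ∧
    (∀ n : ℕ, 1 ≤ n → zagierA (2 * n) 1 = 0) := by
  refine ⟨fun x hx => ?_, ?_, hasMinimalPeriod_zagierA_two, fun n hn => zagierA_zero hn,
    fun n hn => zagierA_one hn⟩
  · obtain ⟨M, hM⟩ := hx.exists_abs_le
    obtain ⟨m, rfl⟩ := exists_int_of_bounded hM
    have hle : m ≤ 2 := by
      by_contra! h
      obtain ⟨j, hj⟩ := Int.eq_ofNat_of_zero_le (show 0 ≤ m - 3 by omega)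
      obtain rfl : m = j + 3 := by omega
      exact not_bounded_zagierA_nat_add_three j M (by simpa using hM)
    have hge : -1 ≤ m := by
      by_contra! h
      obtain ⟨j, hj⟩ := Int.eq_ofNat_of_zero_le (show 0 ≤ -2 - m by omega)
      obtain rfl : m = 1 - (j + 3) := by omega
      refine not_bounded_zagierA_nat_add_three j M fun n hn => ?_
      rw [← zagierA_one_sub n hn]
      simpa using hM n hn
    interval_cases m <;> simp
  · have e (n : ℕ) (hn : 1 ≤ n) : zagierA (2 * n) (-1) = zagierA (2 * n) 2 := by
      rw [← zagierA_one_sub n hn]; norm_num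
    have hiff (q : ℕ) : IsPeriodOfSeq (fun n : ℕ => zagierA (2 * n) (-1)) q
        ↔ IsPeriodOfSeq (fun n : ℕ => zagierA (2 * n) 2) q := by
      refine and_congr_right fun _ => forall₂_congr fun n hn => ?_
      simp only
      rw [e n hn, e (n + q) (by omega)]
    simpa only [HasMinimalPeriod, hiff] using hasMinimalPeriod_zagierA_two
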